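/- For $n\ge 1$ let $AQ_n$ be the $n$-dimensional augmented cube: $AQ_1=K_2$ with vertex set $\{0,1\}$, and for $n\ge 2$ the graph $AQ_n$, with vertex set $\{0,1\}^n$ (binary strings $x_nx_{n-1}\cdots x_1$), consists of two copies of $AQ_{n-1}$, the strings with leading bit $0$ and those with leading bit $1$, where in addition $0x_{n-1}\cdots x_1$ is joined to $1y_{n-1}\cdots y_1$ if and only if either $x_i=y_i$ for all $1\le i\le n-1$ or $x_i\ne y_i$ for all $1\le i\le n-1$. For a graph $G$, a set $F\subseteq E(G)$ is a $2$-edge-cut if $G-F$ is disconnected and every connected component of $G-F$ has more than $2$ vertices; the $2$-extra edge-connectivity $\lambda_2(G)$ is the minimum of $|F|$ over all $2$-edge-cuts $F$ of $G$ (and $+\infty$ if there is none). **Theorem.** For every integer $n\ge 4$, $$\lambda_2(AQ_n)=6n-9 .$$ Equivalently, $6n-9$ is the minimum cardinality of a set $F\subseteq E(AQ_n)$ such that $AQ_n-F$ is disconnected and has neither isolated vertices nor isolated edges (an isolated edge being an edge that shares no end-vertex with another edge). -/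

import Mathlib

/-- The `n`-dimensional augmented cube. A vertex `x_n x_{n-1} ⋯ x_1` is a function `Fin n → Bool`
whose value at index `i` is the bit `x_{i+1}`, so that the leading bit `x_n` is the value at the
last index. `AQ_{n+1}` consists of two copies of `AQ_n` (leading bit `0`, leading bit `1`); two
vertices in different copies are joined iff their remaining bits are all equal or all opposite.
The recursion is started at the one-vertex graph; one step of it gives `AQ_1 = K_2`
(see `augmentedCube_one`). -/
def augmentedCube : (n : ℕ) → SimpleGraph (Fin n → Bool)
  | 0 => ⊥
  | n + 1 =>
    { Adj := fun X Y =>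
        (X (Fin.last n) = Y (Fin.last n) ∧
          (augmentedCube n).Adj (fun i => X i.castSucc) (fun i => Y i.castSucc)) ∨
        (X (Fin.last n) ≠ Y (Fin.last n) ∧
          ((∀ i : Fin n, X i.castSucc = Y i.castSucc) ∨
            (∀ i : Fin n, X i.castSucc = !(Y i.castSucc))))
      symm := ⟨fun X Y h => by
        rcases h with ⟨h, h'⟩ | ⟨h, h' | h'⟩
        · exact Or.inl ⟨h.symm, h'.symm⟩
        · exact Or.inr ⟨h.symm, Or.inl fun i => (h' i).symm⟩
        · exact Or.inr ⟨h.symm, Or.inr fun i => by simp [h' i]⟩⟩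
      loopless := ⟨fun X h => by
        rcases h with ⟨_, h⟩ | ⟨h, _⟩
        · exact (augmentedCube n).irrefl h
        · exact h rfl⟩ }

/-- `AQ_1` is the complete graph on its two vertices. -/
theorem augmentedCube_one : augmentedCube 1 = ⊤ := by
  ext X Y
  have h : X = Y ↔ X (Fin.last 0) = Y (Fin.last 0) := by
    constructor
    · rintro rfl
      rfl
    · intro h
      funext i
      rw [Subsingleton.elim i (Fin.last 0)]
      exact h
  simp [augmentedCube, h]

namespace SimpleGraph

/-- `F` is an edge-cut of `G`: a set of edges whose deletion leaves a disconnected graph. -/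
def IsEdgeCut {V : Type*} (G : SimpleGraph V) (F : Set (Sym2 V)) : Prop :=
  F ⊆ G.edgeSet ∧ ¬ (G.deleteEdges F).Preconnected

/-- `F` is an `h`-edge-cut of `G`: an edge-cut such that every connected component of `G - F`
has more than `h` vertices. -/
def IsExtraEdgeCut {V : Type*} (G : SimpleGraph V) (h : ℕ) (F : Set (Sym2 V)) : Prop :=
  G.IsEdgeCut F ∧
    ∀ C : (G.deleteEdges F).ConnectedComponent, (h : ℕ∞) < C.supp.encard

/-- The `h`-extra edge-connectivity `λ_h(G)`: the minimum cardinality of an `h`-edge-cut,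
with value `⊤` (infinity) if there is none. -/
noncomputable def extraEdgeConnectivity {V : Type*} (G : SimpleGraph V) (h : ℕ) : ℕ∞ :=
  ⨅ F : {F : Set (Sym2 V) // G.IsExtraEdgeCut h F}, F.1.encard

/-- `v` is an isolated vertex of `G`. -/
def IsIsolatedVertex {V : Type*} (G : SimpleGraph V) (v : V) : Prop :=
  ∀ w : V, ¬ G.Adj v w

/-- `uv` is an isolated edge of `G`: an edge that shares no end-vertex with another edge. -/
def IsIsolatedEdge {V : Type*} (G : SimpleGraph V) (u v : V) : Prop :=
  G.Adj u v ∧ (∀ w : V, G.Adj u w → w = v) ∧ (∀ w : V, G.Adj v w → w = u)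

end SimpleGraph

/-!
An extra edge-cut contains all edges leaving some connected component `X` of the remaining graph,
and both `X` and its complement have at least three vertices. So the lower bound is an
isoperimetric inequality (`le_cutSize_augmentedCube`): every such set `X` of vertices of `AQ_n`,
`n ≥ 4`, is left by at least `6n - 9` edges.

This goes by induction on `n`. Split `X` into the parts `X₀`, `X₁` in the two copies of the smaller
cube. The two perfect matchings between the copies contribute at least `2 * |#X₀ - #X₁|` edges
(`cutSize_half_le`). Passing to the complement, assume that `X` has at most half of the vertices.
A part that has, together with its complement, at least three vertices is left by `6n - 9` edges
of its own copy by induction; a part of one or two vertices, or missing one or two vertices, is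
left by many edges because the graph is regular of degree `2n - 1`: a set of `k` vertices is left
by at least `k * (2n - k)` edges (`le_cutSize_of_card`). In every case the contributions add up to
the bound for `n + 1`. The step from `AQ_3` to `AQ_4` is the same, with the bounds by degrees
alone.

The bound is attained by the edges leaving a triangle (`exists_edgeCut_augmentedCube`).
-/

/-! ### Edges leaving a set of vertices -/

open Finset in
/-- The number of edges of `G` with one end in `X` and the other end outside `X`. -/
noncomputable def SimpleGraph.cutSize {V : Type*} [Fintype V] (G : SimpleGraph V)
    (X : Finset V) : ℕ := by
  classical exact ∑ x ∈ X, #{y | G.Adj x y ∧ y ∉ X}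

namespace SimpleGraph

section General

open Finset
open scoped Classical

variable {V : Type*}

/-- The set of edges of `G` with one end in `X` and the other end outside `X`. -/
def cutEdges (G : SimpleGraph V) (X : Set V) : Set (Sym2 V) :=
  {e | ∃ x ∈ X, ∃ y ∉ X, G.Adj x y ∧ e = s(x, y)}

theorem cutSize_eq [Fintype V] (G : SimpleGraph V) (X : Finset V) :
    G.cutSize X = ∑ x ∈ X, #{y | G.Adj x y ∧ y ∉ X} := by
  unfold cutSize
  congr!

theorem cutSize_eq_card [Fintype V] (G : SimpleGraph V) (X : Finset V) :
    G.cutSize X = #{p : V × V | p.1 ∈ X ∧ p.2 ∉ X ∧ G.Adj p.1 p.2} := by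
  rw [cutSize_eq, ← card_sigma]
  refine card_bij' (fun p _ => (p.1, p.2)) (fun p _ => ⟨p.1, p.2⟩) ?_ ?_ ?_ ?_ <;>
    simp +contextual

theorem cutSize_compl [Fintype V] [DecidableEq V] (G : SimpleGraph V) (X : Finset V) :
    G.cutSize Xᶜ = G.cutSize X := by
  rw [cutSize_eq_card, cutSize_eq_card]
  refine card_bij' (fun p _ => p.swap) (fun p _ => p.swap) ?_ ?_ ?_ ?_ <;>
    simp +contextual [G.adj_comm]

theorem encard_cutEdges [Fintype V] (G : SimpleGraph V) (X : Finset V) :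
    (G.cutEdges X).encard = G.cutSize X := by
  have h : G.cutEdges X = (fun p : V × V => s(p.1, p.2)) ''
      (({p : V × V | p.1 ∈ X ∧ p.2 ∉ X ∧ G.Adj p.1 p.2} : Finset (V × V)) : Set (V × V)) := by
    ext e
    simp only [cutEdges, Set.mem_ofPred_eq, Set.mem_image, coe_filter, mem_univ, true_and,
      Prod.exists, mem_coe]
    constructor
    · rintro ⟨x, hx, y, hy, hxy, rfl⟩
      exact ⟨x, y, ⟨hx, hy, hxy⟩, rfl⟩
    · rintro ⟨x, y, ⟨hx, hy, hxy⟩, rfl⟩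
      exact ⟨x, hx, y, hy, hxy, rfl⟩
  rw [h, Set.InjOn.encard_image, Set.encard_coe_eq_coe_finsetCard, cutSize_eq_card]
  rintro ⟨x, y⟩ hp ⟨x', y'⟩ hp' he
  simp only [coe_filter, mem_univ, true_and, Set.mem_ofPred_eq] at hp hp'
  rcases Sym2.eq_iff.1 he with ⟨h₁, h₂⟩ | ⟨h₁, h₂⟩
  · exact Prod.ext h₁ h₂
  · dsimp only at h₁
    subst h₁
    exact absurd hp.1 hp'.2.1

/-- A vertex of `X` has at most `#X - 1` of its neighbours inside `X`. -/
theorem le_cutSize_of_degree [Fintype V] (G : SimpleGraph V) {d : ℕ} (hd : ∀ x, #{y | G.Adj x y} = d)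
    (X : Finset V) : #X * (d + 1 - #X) ≤ G.cutSize X := by
  rw [cutSize_eq, ← smul_eq_mul]
  refine card_nsmul_le_sum _ _ _ fun x hx => ?_
  have h : ({y | G.Adj x y} : Finset V) ⊆
      ({y | G.Adj x y ∧ y ∉ X} : Finset V) ∪ X.erase x := by
    intro y hy
    simp only [mem_filter, mem_univ, true_and, mem_union, mem_erase] at hy ⊢
    have := hy.ne'
    tauto
  have h₁ := (card_le_card h).trans (card_union_le _ _)
  rw [hd, card_erase_of_mem hx] at h₁
  have := card_pos.2 ⟨x, hx⟩
  omega

/-- For a clique every vertex of `X` has exactly `#X - 1` neighbours inside `X`. -/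
theorem cutSize_eq_of_isClique [Fintype V] (G : SimpleGraph V) {d : ℕ} (hd : ∀ x, #{y | G.Adj x y} = d)
    (X : Finset V) (hX : G.IsClique (X : Set V)) : G.cutSize X = #X * (d + 1 - #X) := by
  rw [cutSize_eq, ← smul_eq_mul]
  refine sum_const_nat fun x hx => ?_
  have h : ({y | G.Adj x y} : Finset V) =
      ({y | G.Adj x y ∧ y ∉ X} : Finset V) ∪ X.erase x := by
    ext y
    simp only [mem_filter, mem_univ, true_and, mem_union, mem_erase]
    by_cases hy : y ∈ X
    · have : y ≠ x → G.Adj x y := fun h => hX hx hy h.symm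
      have : G.Adj x y → y ≠ x := fun h => h.ne'
      tauto
    · tauto
  have hdisj : Disjoint ({y | G.Adj x y ∧ y ∉ X} : Finset V) (X.erase x) := by
    rw [Finset.disjoint_left]
    intro y hy hy'
    exact (mem_filter.1 hy).2.2 (mem_of_mem_erase hy')
  have h₁ := congrArg card h
  rw [card_union_of_disjoint hdisj, hd, card_erase_of_mem hx] at h₁
  have := card_pos.2 ⟨x, hx⟩
  omega

/-! ### Edge-cuts and components -/

theorem cutEdges_supp_subset (G : SimpleGraph V) (F : Set (Sym2 V))
    (C : (G.deleteEdges F).ConnectedComponent) : G.cutEdges C.supp ⊆ F := by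
  rintro e ⟨x, hx, y, hy, hxy, rfl⟩
  by_contra hF
  exact hy ((C.mem_supp_congr_adj (by rw [deleteEdges_adj]; exact ⟨hxy, hF⟩)).1 hx)

theorem two_lt_encard_supp {G : SimpleGraph V} {a b c : V} (hab : a ≠ b) (hac : a ≠ c)
    (hbc : b ≠ c) (h₁ : G.Reachable a b) (h₂ : G.Reachable a c) :
    ((2 : ℕ) : ℕ∞) < (G.connectedComponentMk a).supp.encard := by
  have h : ({a, b, c} : Set V) ⊆ (G.connectedComponentMk a).supp := by
    rintro v (rfl | rfl | rfl)
    · rfl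
    · exact ConnectedComponent.sound h₁.symm
    · exact ConnectedComponent.sound h₂.symm
  refine lt_of_lt_of_le ?_ (Set.encard_le_encard h)
  rw [Set.encard_eq_three.2 ⟨a, b, c, hab, hac, hbc, rfl⟩]
  norm_num

theorem two_lt_encard_supp_of_no_isolated (G : SimpleGraph V)
    (hv : ∀ v, ¬ G.IsIsolatedVertex v) (he : ∀ u v, ¬ G.IsIsolatedEdge u v)
    (C : G.ConnectedComponent) : ((2 : ℕ) : ℕ∞) < C.supp.encard := by
  induction C using ConnectedComponent.ind with | _ a
  obtain ⟨b, hab⟩ : ∃ b, G.Adj a b := by simpa [IsIsolatedVertex] using hv a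
  have h := he a b
  simp only [IsIsolatedEdge, hab, true_and, not_and_or, not_forall] at h
  obtain ⟨c, hc, hcb⟩ | ⟨c, hc, hca⟩ := h
  · exact two_lt_encard_supp hab.ne hc.ne (Ne.symm hcb) hab.reachable hc.reachable
  · exact two_lt_encard_supp hab.ne (Ne.symm hca) hc.ne hab.reachable
      (hab.reachable.trans hc.reachable)

/-- Deleting an extra edge-cut splits off a component and leaves another one, so the cut
contains all edges leaving a set that is neither too small nor too large. -/
theorem IsExtraEdgeCut.exists_cutSize_le [Fintype V] [DecidableEq V] {G : SimpleGraph V}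
    {F : Set (Sym2 V)} {h : ℕ} (hF : G.IsExtraEdgeCut h F) :
    ∃ X : Finset V, h < #X ∧ h < #Xᶜ ∧ (G.cutSize X : ℕ∞) ≤ F.encard := by
  obtain ⟨⟨-, hpre⟩, hcomp⟩ := hF
  obtain ⟨u, v, huv⟩ : ∃ u v, ¬ (G.deleteEdges F).Reachable u v := by
    simpa [Preconnected] using hpre
  set C := (G.deleteEdges F).connectedComponentMk u
  set D := (G.deleteEdges F).connectedComponentMk v
  have hCD : C ≠ D := fun h => huv (ConnectedComponent.exact h)
  have key : ∀ E : (G.deleteEdges F).ConnectedComponent, h < #E.supp.toFinset := by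
    intro E
    have := hcomp E
    rw [Set.encard_eq_coe_toFinset_card] at this
    exact_mod_cast this
  refine ⟨C.supp.toFinset, key C, (key D).trans_le (card_le_card ?_), ?_⟩
  · intro x hx
    simp only [Set.mem_toFinset, ConnectedComponent.mem_supp_iff, mem_compl] at hx ⊢
    exact fun hx' => hCD (hx'.symm.trans hx)
  · rw [← encard_cutEdges, Set.coe_toFinset]
    exact Set.encard_le_encard (cutEdges_supp_subset G F C)

theorem isEdgeCut_cutEdges (G : SimpleGraph V) {X : Set V} {u v : V} (hu : u ∈ X) (hv : v ∉ X) :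
    G.IsEdgeCut (G.cutEdges X) := by
  refine ⟨?_, fun hpre => ?_⟩
  · rintro e ⟨x, -, y, -, hxy, rfl⟩
    exact hxy
  · -- a walk from `u` to `v` has a dart leaving `X`, which is a deleted edge
    obtain ⟨p⟩ := hpre u v
    obtain ⟨d, -, hd₁, hd₂⟩ := p.exists_boundary_dart X hu hv
    have := d.adj
    rw [deleteEdges_adj] at this
    exact this.2 ⟨_, hd₁, _, hd₂, this.1, rfl⟩

theorem deleteEdges_cutEdges_adj (G : SimpleGraph V) {X : Set V} {u v : V} (h : G.Adj u v)
    (huv : u ∈ X ↔ v ∈ X) : (G.deleteEdges (G.cutEdges X)).Adj u v := by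
  rw [deleteEdges_adj]
  refine ⟨h, ?_⟩
  rintro ⟨x, hx, y, hy, -, he⟩
  rcases Sym2.eq_iff.1 he with ⟨rfl, rfl⟩ | ⟨rfl, rfl⟩ <;> tauto

end General

end SimpleGraph

/-! ### The augmented cube -/

section AugmentedCube

open Finset
open scoped Classical

/-- The vertices `x` of the smaller cube for which `x`, extended by the leading bit `c`,
lies in `X`. -/
noncomputable def half {n : ℕ} (X : Finset (Fin (n + 1) → Bool)) (c : Bool) :
    Finset (Fin n → Bool) :=
  {x | (Fin.snoc x c : Fin (n + 1) → Bool) ∈ X}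

theorem sum_eq_sum_half {n : ℕ} (X : Finset (Fin (n + 1) → Bool))
    (f : (Fin (n + 1) → Bool) → ℕ) :
    ∑ y ∈ X, f y = ∑ x ∈ half X true, f (Fin.snoc x true) +
      ∑ x ∈ half X false, f (Fin.snoc x false) := by
  have h := (Fin.snocEquiv (fun _ : Fin (n + 1) => Bool)).sum_comp
    (fun y => if y ∈ X then f y else 0)
  rw [Fintype.sum_prod_type, Fintype.sum_bool] at h
  have hX : ∑ y ∈ X, f y = ∑ y, if y ∈ X then f y else 0 := by
    rw [← sum_filter, filter_mem_eq_inter, univ_inter]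
  rw [hX, ← h]
  simp only [half, sum_filter]
  rfl

theorem card_eq_card_half {n : ℕ} (X : Finset (Fin (n + 1) → Bool)) :
    #X = #(half X true) + #(half X false) := by
  simp only [card_eq_sum_ones]
  exact sum_eq_sum_half X fun _ => 1

theorem augmentedCube_adj_snoc {n : ℕ} (x y : Fin n → Bool) (c d : Bool) :
    (augmentedCube (n + 1)).Adj (Fin.snoc x c) (Fin.snoc y d) ↔
      (c = d ∧ (augmentedCube n).Adj x y) ∨ (c ≠ d ∧ (y = x ∨ y = xᶜ)) := by
  simp only [augmentedCube, Fin.snoc_last, Fin.snoc_castSucc]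
  refine or_congr Iff.rfl (and_congr Iff.rfl (or_congr ?_ ?_))
  · rw [funext_iff]
    simp only [eq_comm]
  · rw [funext_iff]
    refine forall_congr' fun i => ?_
    rw [Pi.compl_apply]
    cases x i <;> cases y i <;> simp

theorem compl_ne_self_of_pos {n : ℕ} (hn : 1 ≤ n) (x : Fin n → Bool) : xᶜ ≠ x := by
  intro h
  have := congrFun h ⟨0, hn⟩
  simp at this

theorem card_adj_augmentedCube {n : ℕ} (hn : 1 ≤ n) (x : Fin n → Bool) :
    #{y | (augmentedCube n).Adj x y} = 2 * n - 1 := by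
  induction n, hn using Nat.le_induction with
  | base =>
    have h : ({y | (augmentedCube 1).Adj x y} : Finset _) = univ.erase x := by
      ext y
      simp [augmentedCube_one, eq_comm]
    rw [h, card_erase_of_mem (mem_univ _)]
    simp
  | succ n hn ih =>
    obtain ⟨x, c, rfl⟩ : ∃ (x' : Fin n → Bool) (c : Bool), x = Fin.snoc x' c :=
      ⟨Fin.init x, x (Fin.last n), (Fin.snoc_init_self x).symm⟩
    have hpair : #{y | y = x ∨ y = xᶜ} = 2 := by
      rw [filter_or, filter_eq', filter_eq', if_pos (mem_univ _), if_pos (mem_univ _)]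
      exact card_pair (compl_ne_self_of_pos hn x).symm
    have := ih x
    rw [card_eq_card_half]
    cases c <;> simp [half, augmentedCube_adj_snoc] <;> omega

/-- With `A` in one copy of the smaller cube and `B` in the other: each of the two perfect
matchings between the copies, `x ↦ x` and `x ↦ xᶜ`, sends at least `#A - #B` vertices of `A`
outside `B`. -/
theorem le_sum_card_cross {n : ℕ} (hn : 1 ≤ n) (A B : Finset (Fin n → Bool)) :
    2 * (#A - #B) ≤ ∑ x ∈ A, #{y | (y = x ∨ y = xᶜ) ∧ y ∉ B} := by
  have h : ∀ x ∈ A, #{y | (y = x ∨ y = xᶜ) ∧ y ∉ B} =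
      (if x ∉ B then 1 else 0) + (if xᶜ ∉ B then 1 else 0) := by
    intro x _
    have : ({y | (y = x ∨ y = xᶜ) ∧ y ∉ B} : Finset (Fin n → Bool)) =
        ({x, xᶜ} : Finset (Fin n → Bool)).filter (· ∉ B) := by
      ext y
      simp
    rw [this, card_filter, sum_pair (compl_ne_self_of_pos hn x).symm]
  rw [sum_congr rfl h, sum_add_distrib, ← card_filter, ← card_filter]
  have h₁ : #A - #B ≤ #{x ∈ A | x ∉ B} := by
    rw [← sdiff_eq_filter]
    exact le_card_sdiff B A
  have h₂ : #A - #B ≤ #{x ∈ A | xᶜ ∉ B} := by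
    have hB : #(B.image compl) ≤ #B := card_image_le
    have : A \ B.image compl ⊆ ({x ∈ A | xᶜ ∉ B} : Finset (Fin n → Bool)) := by
      intro x hx
      simp only [mem_sdiff, mem_image, not_exists, not_and, mem_filter] at hx ⊢
      exact ⟨hx.1, fun h => hx.2 _ h (compl_compl x)⟩
    have := (le_card_sdiff (B.image compl) A).trans (card_le_card this)
    omega
  omega

/-- The edges leaving `X` are those leaving a half of `X` within its copy of the smaller cube and
those going across; the truncated subtractions add up to `2 * |#X₁ - #X₀|`. -/
theorem cutSize_half_le {n : ℕ} (hn : 1 ≤ n) (X : Finset (Fin (n + 1) → Bool)) :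
    (augmentedCube n).cutSize (half X true) + (augmentedCube n).cutSize (half X false) +
        2 * (#(half X true) - #(half X false)) + 2 * (#(half X false) - #(half X true)) ≤
      (augmentedCube (n + 1)).cutSize X := by
  have h₁ := le_sum_card_cross hn (half X true) (half X false)
  have h₂ := le_sum_card_cross hn (half X false) (half X true)
  have key : (augmentedCube (n + 1)).cutSize X =
      ((augmentedCube n).cutSize (half X true) +
        ∑ x ∈ half X true, #{y | (y = x ∨ y = xᶜ) ∧ y ∉ half X false}) +
      (∑ x ∈ half X false, #{y | (y = x ∨ y = xᶜ) ∧ y ∉ half X true} +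
        (augmentedCube n).cutSize (half X false)) := by
    simp only [SimpleGraph.cutSize_eq]
    rw [sum_eq_sum_half, ← sum_add_distrib, ← sum_add_distrib]
    refine congrArg₂ _ (sum_congr rfl fun x _ => ?_) (sum_congr rfl fun x _ => ?_) <;>
    · rw [card_eq_card_half]
      simp [half, augmentedCube_adj_snoc]
  omega

/-- The bound by degrees for sets with `k` vertices, and for their complements. -/
theorem le_cutSize_of_card {n : ℕ} (hn : 1 ≤ n) (X : Finset (Fin n → Bool)) {k : ℕ}
    (hk : #X = k ∨ #X + k = 2 ^ n) : k * (2 * n - k) ≤ (augmentedCube n).cutSize X := by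
  have key : ∀ Y : Finset (Fin n → Bool), #Y * (2 * n - #Y) ≤ (augmentedCube n).cutSize Y := by
    intro Y
    have := (augmentedCube n).le_cutSize_of_degree (card_adj_augmentedCube hn) Y
    rwa [Nat.sub_add_cancel (by omega)] at this
  rcases hk with rfl | hk
  · exact key X
  · have hc : #Xᶜ = k := by
      rw [card_compl, Fintype.card_fun, Fintype.card_bool, Fintype.card_fin]
      omega
    rw [← SimpleGraph.cutSize_compl, ← hc]
    exact key _

/-! ### The isoperimetric inequality -/

/-- The isoperimetric inequality behind the lower bound: a set of at least three vertices whose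
complement has at least three vertices is left by at least `6n - 9` edges. -/
theorem le_cutSize_augmentedCube {n : ℕ} (hn : 4 ≤ n) (X : Finset (Fin n → Bool))
    (h₁ : 3 ≤ #X) (h₂ : 3 ≤ #Xᶜ) : 6 * n - 9 ≤ (augmentedCube n).cutSize X := by
  have hcard : ∀ (m : ℕ) (Y : Finset (Fin m → Bool)), #Y + #Yᶜ = 2 ^ m := by
    intro m Y
    rw [card_add_card_compl, Fintype.card_fun, Fintype.card_bool, Fintype.card_fin]
  induction n, hn using Nat.le_induction with
  | base =>
    wlog hX : #X ≤ 2 ^ 3 generalizing X with H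
    · rw [← SimpleGraph.cutSize_compl]
      have := hcard _ X
      exact H _ h₂ (by rwa [compl_compl]) (by omega)
    have hsplit := cutSize_half_le (n := 3) (by norm_num) X
    have hc := card_eq_card_half X
    -- in `AQ_3`, sets of sizes `1, 2, 3, 4` are left by at least `5, 8, 9, 8` edges
    have small : ∀ Y : Finset (Fin 3 → Bool), ∀ k, #Y = k ∨ #Y + k = 8 →
        k * (6 - k) ≤ (augmentedCube 3).cutSize Y :=
      fun Y k hk => le_cutSize_of_card (by norm_num) Y hk
    have t₁ := small (half X true) 1
    have t₂ := small (half X true) 2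
    have t₃ := small (half X true) 3
    have t₄ := small (half X true) 4
    have f₁ := small (half X false) 1
    have f₂ := small (half X false) 2
    have f₃ := small (half X false) 3
    have f₄ := small (half X false) 4
    change _ ≤ (augmentedCube (3 + 1)).cutSize X
    generalize #(half X true) = a at *
    generalize #(half X false) = b at *
    omega
  | succ n hn ih =>
    wlog hX : #X ≤ 2 ^ n generalizing X with H
    · rw [← SimpleGraph.cutSize_compl]
      have := hcard _ X
      rw [pow_succ] at this
      exact H _ h₂ (by rwa [compl_compl]) (by omega)
    have hsplit := cutSize_half_le (by omega) X
    have hc := card_eq_card_half X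
    -- if a half misses at most two vertices of its copy and the other half is small, the cross
    -- edges alone suffice, as `2 ^ n` is large
    have hpow : 4 * n ≤ 2 ^ n := by
      clear * - hn
      induction n, hn using Nat.le_induction with
      | base => norm_num
      | succ n hn ih => rw [pow_succ]; omega
    have small := fun (Y : Finset (Fin n → Bool)) (k : ℕ) =>
      le_cutSize_of_card (k := k) (by omega) Y
    have t₁ := small (half X true) 1
    have t₂ := small (half X true) 2
    have f₁ := small (half X false) 1
    have f₂ := small (half X false) 2
    have tc := hcard _ (half X true)
    have fc := hcard _ (half X false)
    have ti := ih (half X true)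
    have fi := ih (half X false)
    generalize 2 ^ n = N at *
    generalize #(half X true) = a at *
    generalize #(half X false) = b at *
    omega

/-! ### The edges leaving a triangle -/

/-- The graph `AQ_2` is `K_4`, and `AQ_n` is a subgraph of `AQ_{n+1}`. -/
theorem exists_triangle_augmentedCube {n : ℕ} (hn : 2 ≤ n) :
    ∃ a b c, (augmentedCube n).Adj a b ∧ (augmentedCube n).Adj a c ∧
      (augmentedCube n).Adj b c := by
  induction n, hn using Nat.le_induction with
  | base =>
    refine ⟨Fin.snoc (fun _ => false) false, Fin.snoc (fun _ => true) false,
      Fin.snoc (fun _ => false) true, ?_, ?_, ?_⟩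
    · rw [augmentedCube_adj_snoc, augmentedCube_one]
      simp [funext_iff]
    · simp [augmentedCube_adj_snoc]
    · simp [augmentedCube_adj_snoc, funext_iff]
  | succ n hn ih =>
    obtain ⟨a, b, c, hab, hac, hbc⟩ := ih
    exact ⟨Fin.snoc a false, Fin.snoc b false, Fin.snoc c false,
      by simp [augmentedCube_adj_snoc, *], by simp [augmentedCube_adj_snoc, *],
      by simp [augmentedCube_adj_snoc, *]⟩

/-- The edges leaving a triangle form an edge-cut of size `6n - 9`, after whose deletion every
vertex keeps two neighbours: the other two vertices of the triangle, or, for a vertex outside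
it, all but at most three of its `2n - 1` neighbours. -/
theorem exists_edgeCut_augmentedCube {n : ℕ} (hn : 4 ≤ n) :
    ∃ F, (augmentedCube n).IsEdgeCut F ∧ F.encard = ((6 * n - 9 : ℕ) : ℕ∞) ∧
      ∀ v, ∃ x y, x ≠ y ∧ ((augmentedCube n).deleteEdges F).Adj v x ∧
        ((augmentedCube n).deleteEdges F).Adj v y := by
  obtain ⟨a, b, c, hab, hac, hbc⟩ := exists_triangle_augmentedCube (by omega : 2 ≤ n)
  set T : Finset (Fin n → Bool) := {a, b, c} with hT
  have hTc : #T = 3 := card_eq_three.2 ⟨a, b, c, hab.ne, hac.ne, hbc.ne, rfl⟩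
  have hdeg := fun x => card_adj_augmentedCube (by omega : 1 ≤ n) x
  have hclique : (augmentedCube n).IsClique (T : Set (Fin n → Bool)) := by
    simp [hT, SimpleGraph.isClique_iff, Set.Pairwise, hab, hac, hbc, hab.symm, hac.symm, hbc.symm]
  have hout : ∀ v, v ∉ T → ∃ x y, x ≠ y ∧ (x ∉ T ∧ (augmentedCube n).Adj v x) ∧
      (y ∉ T ∧ (augmentedCube n).Adj v y) := by
    intro v _
    have h := le_card_sdiff T ({y | (augmentedCube n).Adj v y} : Finset (Fin n → Bool))
    rw [hdeg, hTc] at h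
    obtain ⟨x, hx, y, hy, hxy⟩ := one_lt_card.1
      (by omega : 1 < #(({y | (augmentedCube n).Adj v y} : Finset (Fin n → Bool)) \ T))
    simp only [mem_sdiff, mem_filter, mem_univ, true_and] at hx hy
    exact ⟨x, y, hxy, hx.symm, hy.symm⟩
  have hv : ∃ v, v ∉ T := by
    by_contra! h
    have hle := card_le_card (fun x _ => h x : (univ : Finset (Fin n → Bool)) ⊆ T)
    rw [hTc, card_univ, Fintype.card_fun, Fintype.card_bool, Fintype.card_fin] at hle
    have := Nat.pow_le_pow_right (n := 2) (by norm_num) hn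
    omega
  obtain ⟨v, hv⟩ := hv
  refine ⟨(augmentedCube n).cutEdges T,
    (augmentedCube n).isEdgeCut_cutEdges (u := a) (by simp [hT]) (mem_coe.not.2 hv), ?_, ?_⟩
  · rw [SimpleGraph.encard_cutEdges, SimpleGraph.cutSize_eq_of_isClique _ hdeg _ hclique, hTc]
    congr 1
    omega
  · intro v
    by_cases hv : v ∈ T
    · have hin : ∀ x ∈ T, x ≠ v →
          ((augmentedCube n).deleteEdges ((augmentedCube n).cutEdges T)).Adj v x :=
        fun x hx hxv => SimpleGraph.deleteEdges_cutEdges_adj _ (hclique hv hx hxv.symm)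
          (by simp [hv, hx])
      obtain ⟨x, hx, y, hy, hxy⟩ := one_lt_card.1
        (by rw [card_erase_of_mem hv]; omega : 1 < #(T.erase v))
      rw [mem_erase] at hx hy
      exact ⟨x, y, hxy, hin x hx.2 hx.1, hin y hy.2 hy.1⟩
    · obtain ⟨x, y, hxy, hx, hy⟩ := hout v hv
      exact ⟨x, y, hxy,
        SimpleGraph.deleteEdges_cutEdges_adj _ hx.2 (by simp [hv, hx.1]),
        SimpleGraph.deleteEdges_cutEdges_adj _ hy.2 (by simp [hv, hy.1])⟩

end AugmentedCube

/-! ### The minimum size of a cut -/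

theorem le_encard_of_isExtraEdgeCut {n : ℕ} (hn : 4 ≤ n) {F : Set (Sym2 (Fin n → Bool))}
    (hF : (augmentedCube n).IsExtraEdgeCut 2 F) : ((6 * n - 9 : ℕ) : ℕ∞) ≤ F.encard := by
  obtain ⟨X, h₁, h₂, hX⟩ := hF.exists_cutSize_le
  refine le_trans ?_ hX
  exact_mod_cast le_cutSize_augmentedCube hn X h₁ h₂

theorem theorem3p2 (n : ℕ) (hn : 4 ≤ n) :
    (augmentedCube n).extraEdgeConnectivity 2 = ((6 * n - 9 : ℕ) : ℕ∞) ∧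
    IsLeast {k : ℕ | ∃ F : Set (Sym2 (Fin n → Bool)),
        (augmentedCube n).IsEdgeCut F ∧
        (∀ v, ¬ ((augmentedCube n).deleteEdges F).IsIsolatedVertex v) ∧
        (∀ u v, ¬ ((augmentedCube n).deleteEdges F).IsIsolatedEdge u v) ∧
        F.encard = (k : ℕ∞)}
      (6 * n - 9) := by
  obtain ⟨F, hcut, hcard, hnbr⟩ := exists_edgeCut_augmentedCube hn
  have hvert : ∀ v, ¬ ((augmentedCube n).deleteEdges F).IsIsolatedVertex v := by
    intro v hv
    obtain ⟨x, -, -, hx, -⟩ := hnbr v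
    exact hv x hx
  have hedge : ∀ u v, ¬ ((augmentedCube n).deleteEdges F).IsIsolatedEdge u v := by
    intro u v huv
    obtain ⟨x, y, hxy, hx, hy⟩ := hnbr u
    exact hxy ((huv.2.1 x hx).trans (huv.2.1 y hy).symm)
  refine ⟨le_antisymm ?_ ?_, ⟨F, hcut, hvert, hedge, hcard⟩, ?_⟩
  · rw [← hcard]
    exact iInf_le (fun F : {F // (augmentedCube n).IsExtraEdgeCut 2 F} => F.1.encard)
      ⟨F, hcut, SimpleGraph.two_lt_encard_supp_of_no_isolated _ hvert hedge⟩
  · exact le_iInf fun F => le_encard_of_isExtraEdgeCut hn F.2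
  · rintro k ⟨F', hcut', hvert', hedge', hk⟩
    have := le_encard_of_isExtraEdgeCut hn
      ⟨hcut', SimpleGraph.two_lt_encard_supp_of_no_isolated _ hvert' hedge'⟩
    rw [hk] at this
    exact_mod_cast this
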